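/- Let $q=2^n\ge 4$, let $h(y)=y^{q/2}+y^{q/4}+\dots+y^2+y\in\mathbb F_{q^2}[y]$, and let $Y_2=\mathbb F_{q^2}(x,y)$ be the function field over $\mathbb F_{q^2}$ defined by $h(y)=x^{q+1}$. Let $P_\infty$ be the unique place of $Y_2$ lying over the infinite place of $\mathbb F_{q^2}(x)$, and let $$G(P_\infty)=\{\sigma\in\mathrm{Aut}(Y_2/\mathbb F_{q^2}) : \sigma(P_\infty)=P_\infty\},$$ where a place is regarded as the maximal ideal of its valuation ring and $\sigma(P)=\{\sigma(z): z\in P\}$. Then an $\mathbb F_{q^2}$-automorphism $\sigma$ of $Y_2$ lies in $G(P_\infty)$ if and only if there are $a,b,c\in\mathbb F_{q^2}$ with $a^{q+1}=1$ and $b^{q+1}=h(c)$ such that $$\sigma(x)=ax+b,\qquad \sigma(y)=y+(ab^q)^2x^2+ab^qx+c .$$ Conversely, for all $a,b,c\in\mathbb F_{q^2}$ with $a^{q+1}=1$ and $b^{q+1}=h(c)$ there is exactly one $\mathbb F_{q^2}$-automorphism $\sigma$ of $Y_2$ given by these formulas. -/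

import Mathlib

open Polynomial
open scoped Pointwise

noncomputable section

namespace AbdonTorres

/-! ### Places of a function field -/

/-- A place of the function field `F / K`, given by its valuation ring `𝒪`: a valuation ring of
the field `F` with `K ⊆ 𝒪 ⊊ F`. -/
structure Place (K F : Type*) [Field K] [Field F] [Algebra K F] where
  valuationRing : ValuationSubring F
  algebraMap_mem : ∀ c : K, algebraMap K F c ∈ valuationRing
  ne_top : valuationRing ≠ ⊤

namespace Place

variable {K F : Type*} [Field K] [Field F] [Algebra K F]

/-- The maximal ideal of the valuation ring of a place, as a subset of the field `F`. -/
def ideal (P : Place K F) : Set F :=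
  {z | ∃ hz : z ∈ P.valuationRing,
    (⟨z, hz⟩ : P.valuationRing) ∈ IsLocalRing.maximalIdeal P.valuationRing}

/-- The stabilizer `{σ ∈ Aut(F/K) : σ(P) = P}` of the place `P`, where `P` is regarded as the
maximal ideal of its valuation ring and `σ(P) = {σ(z) : z ∈ P}`. -/
def stabilizer (P : Place K F) : Subgroup (F ≃ₐ[K] F) :=
  MulAction.stabilizer (F ≃ₐ[K] F) P.ideal

theorem mem_stabilizer (P : Place K F) (σ : F ≃ₐ[K] F) :
    σ ∈ P.stabilizer ↔ σ '' P.ideal = P.ideal :=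
  Iff.rfl

end Place

/-! ### The Abdón–Torres function field -/

/-- The polynomial `h(y) = y^(q/2) + y^(q/4) + ⋯ + y² + y`, where `q = 2 ^ n`. -/
def h (K : Type*) [Field K] (n : ℕ) : K[X] :=
  ∑ i ∈ Finset.range n, X ^ 2 ^ i

/-- The polynomial `h(Y) - x^(q+1)` in `K(x)[Y]`, where `q = 2 ^ n`. -/
def defPoly (K : Type*) [Field K] (n : ℕ) : (RatFunc K)[X] :=
  (h K n).map (algebraMap K (RatFunc K)) - C (RatFunc.X ^ (2 ^ n + 1))

/-- The field `Y₂ = K(x, y)` with `h(y) = x^(q+1)`, that is `K(x)[Y] / (h(Y) - x^(q+1))`. -/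
abbrev Y₂ (K : Type*) [Field K] (n : ℕ) : Type _ := AdjoinRoot (defPoly K n)

section irreducible

variable (K : Type*) [Field K]

theorem h_coeff_zero (n : ℕ) : (h K n).coeff 0 = 0 := by
  rw [h, finsetSum_coeff]
  refine Finset.sum_eq_zero fun i _ => ?_
  rw [coeff_X_pow, if_neg (by positivity)]

theorem h_coeff_one (n : ℕ) [NeZero n] : (h K n).coeff 1 = 1 := by
  have h1 : ∀ i : ℕ, (1 = 2 ^ i) ↔ 0 = i := by
    intro i; rw [eq_comm]; simp [eq_comm]
  simp [h, coeff_X_pow, h1, NeZero.pos n]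

theorem h_succ_monic_natDegree (m : ℕ) :
    (h K (m + 1)).Monic ∧ (h K (m + 1)).natDegree = 2 ^ m := by
  have hlt : (h K m).degree < ((2 ^ m : ℕ) : WithBot ℕ) := by
    refine (degree_sum_le _ _).trans_lt ?_
    rw [Finset.sup_lt_iff (WithBot.bot_lt_coe _)]
    intro i hi
    rw [degree_X_pow]
    exact_mod_cast Nat.pow_lt_pow_right (by norm_num) (Finset.mem_range.1 hi)
  have e : h K (m + 1) = X ^ 2 ^ m + h K m := by
    rw [h, Finset.sum_range_succ, add_comm]; rfl
  have hm : (h K (m + 1)).Monic := by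
    rw [e]; exact monic_X_pow_add hlt
  refine ⟨hm, ?_⟩
  rw [e]
  exact natDegree_eq_of_degree_eq_some
    (by rw [degree_add_eq_left_of_degree_lt (by simpa using hlt), degree_X_pow])

/-- Irreducibility of `h(Y) - X^(q+1)` in `K[X][Y]`. -/
theorem irreducible_bivariate (n : ℕ) [NeZero n] :
    Irreducible ((h K n).map C - C (X ^ (2 ^ n + 1)) : K[X][X]) := by
  have key : Irreducible (X ^ (2 ^ n + 1) - C (h K n) : K[X][X]) := by
    have hmon : (X ^ (2 ^ n + 1) - C (h K n) : K[X][X]).Monic :=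
      monic_X_pow_sub_C _ (Nat.succ_ne_zero _)
    have hP : (Ideal.span {(X : K[X])}).IsPrime :=
      (Ideal.span_singleton_prime X_ne_zero).2 prime_X
    have hmem : h K n ∈ Ideal.span {(X : K[X])} := by
      rw [Ideal.mem_span_singleton, X_dvd_iff, h_coeff_zero]
    have hE : (X ^ (2 ^ n + 1) - C (h K n) : K[X][X]).IsEisensteinAt
        (Ideal.span {(X : K[X])}) := by
      refine hmon.isEisensteinAt_of_mem_of_notMem hP.ne_top ?_ ?_
      · intro k hk
        rw [natDegree_X_pow_sub_C] at hk
        rw [coeff_sub, coeff_X_pow, if_neg hk.ne, coeff_C, zero_sub]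
        split_ifs
        · exact neg_mem hmem
        · simp
      · rw [coeff_sub, coeff_X_pow, if_neg (Nat.succ_ne_zero _).symm, coeff_C, if_pos rfl,
          zero_sub, neg_mem_iff, Ideal.span_singleton_pow, Ideal.mem_span_singleton, X_pow_dvd_iff]
        intro hc
        have := hc 1 (by norm_num)
        rw [h_coeff_one] at this
        exact one_ne_zero this
    exact hE.irreducible hP hmon.isPrimitive
      (by rw [natDegree_X_pow_sub_C]; exact Nat.succ_pos _)
  have h2 := (MulEquiv.irreducible_iff (Bivariate.swap (R := K))).2 key
  have e : Bivariate.swap (X ^ (2 ^ n + 1) - C (h K n) : K[X][X]) =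
      - ((h K n).map C - C (X ^ (2 ^ n + 1))) := by
    rw [map_sub, Bivariate.swap_C, map_pow, Bivariate.swap_Y, C_pow]; ring
  rw [e] at h2
  exact (Associated.neg_left (Associated.refl _)).irreducible h2

theorem irreducible_defPoly (n : ℕ) [NeZero n] : Irreducible (defPoly K n) := by
  have hmon : ((h K n).map C - C (X ^ (2 ^ n + 1)) : K[X][X]).Monic := by
    obtain ⟨m, rfl⟩ := Nat.exists_eq_succ_of_ne_zero (NeZero.ne n)
    obtain ⟨h1, h2⟩ := h_succ_monic_natDegree K m
    refine (h1.map C).sub_of_left ?_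
    refine degree_C_le.trans_lt ?_
    rw [h1.degree_map, degree_eq_natDegree h1.ne_zero, h2]
    exact_mod_cast Nat.pow_pos (by norm_num)
  have h1 := (hmon.irreducible_iff_irreducible_map_fraction_map (K := RatFunc K)).1
    (irreducible_bivariate K n)
  convert! h1 using 1
  rw [defPoly, Polynomial.map_sub, Polynomial.map_map, Polynomial.map_C,
    map_pow (algebraMap K[X] (RatFunc K)), RatFunc.algebraMap_X]
  congr 2

end irreducible

instance (K : Type*) [Field K] (n : ℕ) [NeZero n] : Fact (Irreducible (defPoly K n)) :=
  ⟨irreducible_defPoly K n⟩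

section generators

variable (K : Type*) [Field K] (n : ℕ)

/-- The generator `x` of `Y₂`. -/
def x : Y₂ K n := algebraMap (RatFunc K) (Y₂ K n) RatFunc.X

/-- The generator `y` of `Y₂`. -/
def y : Y₂ K n := AdjoinRoot.root (defPoly K n)

/-- The defining equation `h(y) = x^(q+1)`. -/
theorem aeval_y : aeval (y K n) (h K n) = x K n ^ (2 ^ n + 1) := by
  have e : aeval (AdjoinRoot.root (defPoly K n)) (defPoly K n) = 0 :=
    AdjoinRoot.aeval_eq _ |>.trans AdjoinRoot.mk_self
  have e2 : aeval (AdjoinRoot.root (defPoly K n))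
      ((h K n).map (algebraMap K (RatFunc K)) - C (RatFunc.X ^ (2 ^ n + 1))) = 0 := e
  rw [map_sub, aeval_map_algebraMap, aeval_C, map_pow, sub_eq_zero] at e2
  exact e2

end generators

/-! ### The place at infinity -/

/-- A place of `Y₂` lies over the infinite place of `K(x)` if its valuation ring intersects `K(x)`
in the ring `{f : f = 0 or deg f ≤ 0}`. (In Mathlib the zero function has `intDegree` zero.) -/
def Place.LiesOverInfinity {K : Type*} [Field K] {n : ℕ} [NeZero n] (P : Place K (Y₂ K n)) :
    Prop :=
  ∀ r : RatFunc K, algebraMap (RatFunc K) (Y₂ K n) r ∈ P.valuationRing ↔ r.intDegree ≤ 0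

section infinity

variable (K : Type*) [Field K] (n : ℕ) [NeZero n]

theorem exists_liesOverInfinity : ∃ P : Place K (Y₂ K n), P.LiesOverInfinity := by
  classical
  let O := (RatFunc.inftyValuation K).valuationSubring
  have hO : ∀ r : RatFunc K, r ∈ O ↔ r.intDegree ≤ 0 := by
    intro r
    rw [Valuation.mem_valuationSubring_iff, RatFunc.inftyValuation_apply]
    by_cases h0 : r = 0
    · simp [h0, RatFunc.inftyValuationDef]
    · rw [RatFunc.inftyValuation_of_nonzero K h0, ← WithZero.exp_zero, WithZero.exp_le_exp]
  let f : O →+* Y₂ K n := (algebraMap (RatFunc K) (Y₂ K n)).comp O.subtype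
  obtain ⟨A, hA, hloc⟩ := IsLocalRing.exists_factor_valuationRing f
  have hle : ∀ r : RatFunc K, r ∈ O → algebraMap (RatFunc K) (Y₂ K n) r ∈ A :=
    fun r hr => hA ⟨r, hr⟩
  have hge : ∀ r : RatFunc K, algebraMap (RatFunc K) (Y₂ K n) r ∈ A → r ∈ O := by
    intro r hr
    by_contra hrO
    have hinv : r⁻¹ ∈ O := (O.mem_or_inv_mem r).resolve_left hrO
    have hr0 : r ≠ 0 := fun h0 => hrO (h0 ▸ O.zero_mem)
    have hu : IsUnit (f.codRestrict A.toSubring hA ⟨r⁻¹, hinv⟩) := by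
      refine IsUnit.of_mul_eq_one ⟨_, hr⟩ (Subtype.ext ?_)
      change algebraMap (RatFunc K) (Y₂ K n) r⁻¹ * algebraMap (RatFunc K) (Y₂ K n) r = 1
      rw [← map_mul, inv_mul_cancel₀ hr0, map_one]
    obtain ⟨s, hs⟩ := (hloc.map_nonunit _ hu).exists_right_inv
    have hs' : r⁻¹ * (s : RatFunc K) = 1 := congrArg Subtype.val hs
    have : (s : RatFunc K) = r := by
      rw [inv_mul_eq_iff_eq_mul₀ hr0, mul_one] at hs'; exact hs'
    exact hrO (this ▸ s.2)
  refine ⟨⟨A, fun c => ?_, fun htop => ?_⟩, fun r => ⟨fun hr => (hO r).1 (hge r hr),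
    fun hr => hle r ((hO r).2 hr)⟩⟩
  · rw [IsScalarTower.algebraMap_apply K (RatFunc K) (Y₂ K n)]
    exact hle _ ((hO _).2 (RatFunc.intDegree_C c).le)
  · have hX := (hO _).1 (hge RatFunc.X (htop ▸ trivial))
    rw [RatFunc.intDegree_X] at hX
    exact absurd hX (by norm_num)

variable {K n}

/-- For a place `P` of `Y₂` over the infinite place, `v(f(x)) = v(x) ^ (deg f)`. -/
theorem Place.LiesOverInfinity.valuation_algebraMap {P : Place K (Y₂ K n)}
    (hP : P.LiesOverInfinity) {r : RatFunc K} (hr : r ≠ 0) :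
    P.valuationRing.valuation (algebraMap (RatFunc K) (Y₂ K n) r) =
      P.valuationRing.valuation (x K n) ^ r.intDegree := by
  have hXp : ∀ d : ℤ, (RatFunc.X ^ d : RatFunc K).intDegree = d := by
    have hnat : ∀ k : ℕ, (RatFunc.X ^ k : RatFunc K).intDegree = k := by
      intro k
      rw [← RatFunc.algebraMap_X, ← map_pow, RatFunc.intDegree_polynomial, natDegree_X_pow]
    intro d
    obtain ⟨k, rfl | rfl⟩ := d.eq_nat_or_neg
    · rw [zpow_natCast, hnat]
    · rw [zpow_neg, zpow_natCast, RatFunc.intDegree_inv, hnat]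
  have hX0 : (RatFunc.X ^ r.intDegree : RatFunc K) ≠ 0 := zpow_ne_zero _ RatFunc.X_ne_zero
  have hs : (r / RatFunc.X ^ r.intDegree).intDegree = 0 := by
    rw [RatFunc.intDegree_div hr hX0, hXp, sub_self]
  have h1 : P.valuationRing.valuation
      (algebraMap (RatFunc K) (Y₂ K n) (r / RatFunc.X ^ r.intDegree)) = 1 := by
    refine le_antisymm ((P.valuationRing.valuation_le_one_iff _).2 ((hP _).2 hs.le)) ?_
    have h2 : (algebraMap (RatFunc K) (Y₂ K n) (r / RatFunc.X ^ r.intDegree))⁻¹ ∈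
        P.valuationRing := by
      rw [← map_inv₀, hP, RatFunc.intDegree_inv, hs, neg_zero]
    rw [← P.valuationRing.valuation_le_one_iff, map_inv₀] at h2
    exact (inv_le_one₀ (by
      rw [zero_lt_iff, Valuation.ne_zero_iff, _root_.map_ne_zero]
      exact div_ne_zero hr hX0)).1 h2
  rw [map_div₀, map_div₀, map_zpow₀, map_zpow₀] at h1
  exact (div_eq_one_iff_eq (by
    exact zpow_ne_zero _ ((Valuation.ne_zero_iff _).2 ((_root_.map_ne_zero _).2
      RatFunc.X_ne_zero)))).1 h1

theorem Place.LiesOverInfinity.one_lt_valuation_x {P : Place K (Y₂ K n)}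
    (hP : P.LiesOverInfinity) : 1 < P.valuationRing.valuation (x K n) := by
  rw [← not_le, P.valuationRing.valuation_le_one_iff, x, hP, RatFunc.intDegree_X]
  norm_num

/-- For a place `P` of `Y₂` over the infinite place, `v(y) ^ (q/2) = v(x) ^ (q+1)`. -/
theorem Place.LiesOverInfinity.valuation_y_pow {m : ℕ} {P : Place K (Y₂ K (m + 1))}
    (hP : P.LiesOverInfinity) :
    P.valuationRing.valuation (y K (m + 1)) ^ 2 ^ m =
      P.valuationRing.valuation (x K (m + 1)) ^ (2 ^ (m + 1) + 1) := by
  set v := P.valuationRing.valuation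
  have hxy := aeval_y K (m + 1)
  have hsum : aeval (y K (m + 1)) (h K (m + 1)) =
      ∑ i ∈ Finset.range (m + 1), y K (m + 1) ^ 2 ^ i := by simp [h]
  have hx1 : 1 < v (x K (m + 1)) := hP.one_lt_valuation_x
  have hy1 : 1 < v (y K (m + 1)) := by
    by_contra hle
    rw [not_lt] at hle
    have : v (x K (m + 1) ^ (2 ^ (m + 1) + 1)) ≤ 1 := by
      rw [← hxy, hsum]
      refine v.map_sum_le fun i _ => ?_
      rw [map_pow]; exact pow_le_one₀ zero_le hle
    rw [map_pow] at this
    exact absurd this (not_le.2 (one_lt_pow₀ hx1 (Nat.succ_ne_zero _)))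
  have hlead : v (∑ i ∈ Finset.range (m + 1), y K (m + 1) ^ 2 ^ i) =
      v (y K (m + 1) ^ 2 ^ m) := by
    refine v.map_sum_eq_of_lt (j := m) (Finset.self_mem_range_succ m) fun i hi => ?_
    rw [Finset.mem_sdiff, Finset.mem_range, Finset.mem_singleton] at hi
    rw [map_pow, map_pow]
    exact pow_lt_pow_right₀ hy1 (Nat.pow_lt_pow_right (by norm_num) (by omega))
  rw [← map_pow, ← hlead, ← hsum, hxy, map_pow]

/-- The valuation ring of a place over the infinite place in terms of the `K(x)`-basis `y ^ j`,
`0 ≤ j < q/2`. -/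
theorem Place.LiesOverInfinity.aeval_mem_iff {m : ℕ} {P : Place K (Y₂ K (m + 1))}
    (hP : P.LiesOverInfinity) {f : (RatFunc K)[X]} (hf : f.natDegree < 2 ^ m) :
    aeval (y K (m + 1)) f ∈ P.valuationRing ↔ ∀ j < 2 ^ m, f.coeff j = 0 ∨
      (f.coeff j).intDegree * (2 ^ m : ℕ) + j * (2 ^ (m + 1) + 1 : ℕ) ≤ 0 := by
  set v := P.valuationRing.valuation with hv
  set t : ℕ → Y₂ K (m + 1) := fun j => f.coeff j • y K (m + 1) ^ j with ht
  have hN : 2 ^ m ≠ 0 := by positivity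
  have hx1 : 1 < v (x K (m + 1)) := hP.one_lt_valuation_x
  have hx0 : 0 < v (x K (m + 1)) := zero_lt_one.trans hx1
  have hpow : ∀ j, f.coeff j ≠ 0 → v (t j) ^ 2 ^ m = v (x K (m + 1)) ^
      ((f.coeff j).intDegree * (2 ^ m : ℕ) + j * (2 ^ (m + 1) + 1 : ℕ) : ℤ) := by
    intro j hj
    have hy := hP.valuation_y_pow
    rw [ht]
    simp only
    rw [Algebra.smul_def, map_mul, hP.valuation_algebraMap hj, map_pow, mul_pow, ← pow_mul,
      mul_comm j, pow_mul, hy, ← pow_mul, zpow_add₀ hx0.ne', zpow_mul, zpow_natCast]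
    congr 1
    rw [mul_comm, ← zpow_natCast]
    push_cast
    rfl
  have hzero : ∀ j, f.coeff j = 0 → t j = 0 := fun j hj => by rw [ht]; simp only; rw [hj, zero_smul]
  have hterm : ∀ j, v (t j) ≤ 1 ↔ f.coeff j = 0 ∨
      (f.coeff j).intDegree * (2 ^ m : ℕ) + j * (2 ^ (m + 1) + 1 : ℕ) ≤ 0 := by
    intro j
    by_cases hj : f.coeff j = 0
    · simp [hzero j hj, hj]
    · rw [← pow_le_one_iff_of_nonneg zero_le hN, hpow j hj, zpow_le_one_iff_right₀ hx1]
      simp [hj]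
  have hinj : ∀ i < 2 ^ m, ∀ j < 2 ^ m, i ≠ j → f.coeff i ≠ 0 → f.coeff j ≠ 0 →
      v (t i) ≠ v (t j) := by
    intro i hi j hj hij hci hcj heq
    have h1 := (hpow i hci).symm.trans ((congrArg (· ^ 2 ^ m) heq).trans (hpow j hcj))
    have h2 := zpow_right_injective₀ hx0 hx1.ne' h1
    have h3 : ((2 ^ m : ℕ) : ℤ) ∣ (i : ℤ) - j :=
      ⟨(f.coeff j).intDegree - (f.coeff i).intDegree - 2 * ((i : ℤ) - j), by
        push_cast at h2 ⊢; rw [pow_succ] at h2; linarith⟩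
    have h4 : (i : ℤ) - j = 0 :=
      Int.eq_zero_of_abs_lt_dvd h3 (by rw [abs_lt]; constructor <;> omega)
    omega
  rw [← P.valuationRing.valuation_le_one_iff, aeval_eq_sum_range' hf]
  refine ⟨fun hle => ?_, fun hall => v.map_sum_le fun j hj =>
    (hterm j).2 (hall j (Finset.mem_range.1 hj))⟩
  obtain ⟨k, hk, hmax⟩ := Finset.exists_max_image (Finset.range (2 ^ m)) (fun j => v (t j))
    ⟨0, Finset.mem_range.2 (Nat.pos_of_ne_zero hN)⟩
  have hk1 : v (t k) ≤ 1 := by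
    by_cases hck : f.coeff k = 0
    · simp [hzero k hck]
    · rw [← v.map_sum_eq_of_lt (f := t) hk]
      · exact hle
      · intro i hi
        rw [Finset.mem_sdiff, Finset.mem_singleton] at hi
        by_cases hci : f.coeff i = 0
        · rw [hzero i hci, map_zero]
          have := hpow k hck
          refine zero_lt_iff.2 fun h0 => ?_
          rw [h0, zero_pow hN] at this
          exact (zpow_pos hx0 _).ne this
        · exact lt_of_le_of_ne (hmax i hi.1)
            (hinj i (Finset.mem_range.1 hi.1) k (Finset.mem_range.1 hk) hi.2 hci hck)
  exact fun j hj => (hterm j).1 ((hmax j (Finset.mem_range.2 hj)).trans hk1)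

theorem Place.LiesOverInfinity.eq {P Q : Place K (Y₂ K n)} (hP : P.LiesOverInfinity)
    (hQ : Q.LiesOverInfinity) : P = Q := by
  obtain ⟨m, rfl⟩ := Nat.exists_eq_succ_of_ne_zero (NeZero.ne n)
  have hirr := irreducible_defPoly K (m + 1)
  obtain ⟨A, hA, hA'⟩ := P
  obtain ⟨B, hB, hB'⟩ := Q
  have : A = B := by
    ext z
    obtain ⟨f, hf, rfl⟩ := (AdjoinRoot.powerBasis hirr.ne_zero).exists_eq_aeval z
    have hdeg : (defPoly K (m + 1)).natDegree = 2 ^ m := by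
      rw [defPoly, natDegree_sub_C, natDegree_map, (h_succ_monic_natDegree K m).2]
    rw [AdjoinRoot.powerBasis_dim, hdeg] at hf
    rw [AdjoinRoot.powerBasis_gen]
    exact (hP.aeval_mem_iff hf).trans (hQ.aeval_mem_iff hf).symm
  subst this
  rfl

variable (K n)

/-- The place `P_∞` of `Y₂` over the infinite place of `K(x)`; it is unique by
`Place.LiesOverInfinity.eq`. -/
def placeInfinity : Place K (Y₂ K n) := (exists_liesOverInfinity K n).choose

theorem placeInfinity_liesOverInfinity : (placeInfinity K n).LiesOverInfinity :=
  (exists_liesOverInfinity K n).choose_spec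

theorem liesOverInfinity_iff (P : Place K (Y₂ K n)) :
    P.LiesOverInfinity ↔ P = placeInfinity K n :=
  ⟨fun hP => hP.eq (placeInfinity_liesOverInfinity K n),
    fun e => e ▸ placeInfinity_liesOverInfinity K n⟩

end infinity

end AbdonTorres

end

/-!
Let `P_∞` be the place of `Y₂` over the infinite place of `K(x)`. Since `h' = 1` in characteristic
two, the power basis `1, y, …, y ^ (q/2 - 1)` has discriminant `1`, so the integral closure of
`K[x]` in `Y₂` is `K[x, y]` (`exists_eq_aeval_of_isIntegral`). It is also the ring of functions
without poles outside `P_∞` (`isIntegral_iff_forall_place`), because `P_∞` is the only pole of `x`;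
so an automorphism `σ` fixing `P_∞` preserves it, and it preserves the comparison of pole orders at
`P_∞`.

The pole orders of `x` and `y` at `P_∞` are `q/2` and `q + 1`, so those of the monomials `xⁱ yʲ`
with `j < q/2` are pairwise distinct. Hence `1, x` span the functions in `K[x, y]` of pole order at
most that of `x`, and `1, x, x², y` span those of pole order at most that of `y`. Either `σ(x)` or
`σ⁻¹(x)` has pole order at most that of `x`, and in both cases `σ(x) = a x + b`; likewise
`σ(y) = d y + e x² + f x + c` (`map_x_of_mem_stabilizer`, `map_y_of_mem_stabilizer`). Comparing
coefficients in `h(σ(y)) = σ(x) ^ (q + 1)`, where `h` is additive, gives `d = 1`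
(`coeff_y_eq_one`) and the relations between `a, b, c, e, f` (`coeff_x_relations`).

Conversely `h(f² x²) + h(f x)` telescopes to `(f x) ^ q + f x`, so the formulas respect the
defining equation (`aeval_h_transform`) and define an automorphism (`exists_algEquiv`). It maps `x`
to `a x + b` with `a ≠ 0`, hence fixes the only pole of `x` (`mem_stabilizer_of_map_x`).
-/

noncomputable section

namespace AbdonTorres

/-! ### Stabilizers of places -/

namespace Place

variable {K F : Type*} [Field K] [Field F] [Algebra K F]

theorem mem_ideal_iff (P : Place K F) (z : F) : z ∈ P.ideal ↔ z ∈ P.valuationRing.nonunits :=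
  ValuationSubring.mem_nonunits_iff_exists_mem_maximalIdeal.symm

/-- The inverse image of a place under an automorphism of `F / K`. -/
def comap (P : Place K F) (σ : F ≃ₐ[K] F) : Place K F where
  valuationRing := P.valuationRing.comap (σ : F →+* F)
  algebraMap_mem c := by
    simpa [ValuationSubring.mem_comap] using P.algebraMap_mem c
  ne_top htop := P.ne_top <| by
    ext z
    have hz : σ.symm z ∈ P.valuationRing.comap (σ : F →+* F) := htop ▸ ValuationSubring.mem_top _
    simpa [ValuationSubring.mem_comap] using hz

theorem mem_comap_valuationRing (P : Place K F) (σ : F ≃ₐ[K] F) (z : F) :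
    z ∈ (P.comap σ).valuationRing ↔ σ z ∈ P.valuationRing :=
  Iff.rfl

theorem ext_valuationRing {P Q : Place K F} (hPQ : P.valuationRing = Q.valuationRing) : P = Q := by
  obtain ⟨A, _, _⟩ := P
  obtain ⟨B, _, _⟩ := Q
  subst hPQ
  rfl

/-- An automorphism fixes the maximal ideal of a place if and only if it fixes its valuation
ring, since each of the two determines the other. -/
theorem mem_stabilizer_iff_comap_eq (P : Place K F) (σ : F ≃ₐ[K] F) :
    σ ∈ P.stabilizer ↔ P.comap σ = P := by
  have hmem : ∀ z, z ∈ (P.comap σ).valuationRing.nonunits ↔ σ z ∈ P.valuationRing.nonunits := by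
    intro z
    simp only [ValuationSubring.mem_nonunits_iff_or, mem_comap_valuationRing, map_inv₀,
      EmbeddingLike.map_eq_zero_iff]
  have hcomap : P.comap σ = P ↔
      (P.comap σ).valuationRing.nonunits = P.valuationRing.nonunits :=
    ⟨fun e => by rw [e], fun e => ext_valuationRing (ValuationSubring.nonunits_injective e)⟩
  rw [mem_stabilizer, hcomap, Set.ext_iff, SetLike.ext_iff]
  simp only [hmem, ← mem_ideal_iff]
  constructor
  · intro e z
    rw [← e]
    exact σ.injective.mem_set_image
  · intro e z
    obtain ⟨w, rfl⟩ := σ.surjective z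
    rw [σ.injective.mem_set_image, e]

theorem mem_stabilizer_iff (P : Place K F) (σ : F ≃ₐ[K] F) :
    σ ∈ P.stabilizer ↔ ∀ z, σ z ∈ P.valuationRing ↔ z ∈ P.valuationRing := by
  rw [mem_stabilizer_iff_comap_eq]
  refine ⟨fun e z => ?_, fun hall => ext_valuationRing (SetLike.ext hall)⟩
  conv_rhs => rw [← e]
  exact Iff.rfl

theorem valuation_map_le_iff {P : Place K F} {σ : F ≃ₐ[K] F} (hσ : σ ∈ P.stabilizer) (z w : F) :
    P.valuationRing.valuation (σ z) ≤ P.valuationRing.valuation (σ w) ↔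
      P.valuationRing.valuation z ≤ P.valuationRing.valuation w := by
  rw [mem_stabilizer_iff] at hσ
  by_cases hw : w = 0
  · simp [hw]
  have hpos : ∀ u : F, u ≠ 0 → 0 < P.valuationRing.valuation u := fun u hu =>
    zero_lt_iff.2 ((Valuation.ne_zero_iff _).2 hu)
  rw [← div_le_one₀ (hpos w hw), ← div_le_one₀ (hpos _ (by simpa using hw)), ← map_div₀,
    ← map_div₀, ← map_div₀, ValuationSubring.valuation_le_one_iff,
    ValuationSubring.valuation_le_one_iff, hσ]

theorem isTrivialOn (P : Place K F) : P.valuationRing.valuation.IsTrivialOn K where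
  eq_one c hc := by
    refine le_antisymm ((P.valuationRing.valuation_le_one_iff _).2 (P.algebraMap_mem c)) ?_
    have hinv := (P.valuationRing.valuation_le_one_iff _).2 (P.algebraMap_mem c⁻¹)
    rw [map_inv₀, map_inv₀] at hinv
    exact (inv_le_one₀ (zero_lt_iff.2 ((Valuation.ne_zero_iff _).2
      ((_root_.map_ne_zero _).2 hc)))).1 hinv

end Place

/-! ### Poles of `x` -/

section poles

variable {K : Type*} [Field K] {n : ℕ} [NeZero n]

/-- The infinite place of `K(x)` is the only one at which `x` has a pole. -/
theorem Place.liesOverInfinity_of_x_notMem {P : Place K (Y₂ K n)}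
    (hx : x K n ∉ P.valuationRing) : P.LiesOverInfinity := by
  intro r
  have htriv := P.isTrivialOn
  set v := P.valuationRing.valuation.comap (algebraMap (RatFunc K) (Y₂ K n)) with hv
  have hvtriv : v.IsTrivialOn K := ⟨fun c hc => by
    rw [hv, Valuation.comap_apply, ← IsScalarTower.algebraMap_apply]
    exact htriv.eq_one c hc⟩
  have hX : 1 < v RatFunc.X := by
    rw [← not_le]
    exact fun hle => hx ((P.valuationRing.valuation_le_one_iff _).1 hle)
  rw [← P.valuationRing.valuation_le_one_iff]
  change v r ≤ 1 ↔ _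
  by_cases hr : r = 0
  · simp [hr]
  · rw [RatFunc.valuation_eq_valuation_X_zpow_intDegree_of_one_lt_valuation_X hX hr,
      zpow_le_one_iff_right₀ hX]

theorem x_notMem_placeInfinity : x K n ∉ (placeInfinity K n).valuationRing := by
  rw [← ValuationSubring.valuation_le_one_iff, not_le]
  exact (placeInfinity_liesOverInfinity K n).one_lt_valuation_x

theorem Place.eq_placeInfinity_iff (P : Place K (Y₂ K n)) :
    P = placeInfinity K n ↔ x K n ∉ P.valuationRing :=
  ⟨fun e => e ▸ x_notMem_placeInfinity, fun hx =>
    (liesOverInfinity_iff K n P).1 (liesOverInfinity_of_x_notMem hx)⟩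

/-- An automorphism that maps `x` to a nonconstant polynomial of degree one in `x` fixes the
only pole of `x`. -/
theorem mem_stabilizer_of_map_x {σ : Y₂ K n ≃ₐ[K] Y₂ K n} {a b : K} (ha : a ≠ 0)
    (hσ : σ (x K n) = algebraMap K _ a * x K n + algebraMap K _ b) :
    σ ∈ (placeInfinity K n).stabilizer := by
  rw [Place.mem_stabilizer_iff_comap_eq, Place.eq_placeInfinity_iff,
    Place.mem_comap_valuationRing, hσ]
  intro hmem
  set O := (placeInfinity K n).valuationRing
  have hb := (placeInfinity K n).algebraMap_mem b
  have h1 := O.mul_mem _ _ ((placeInfinity K n).algebraMap_mem a⁻¹)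
    (sub_mem hmem hb)
  rw [add_sub_cancel_right, ← mul_assoc, ← map_mul, inv_mul_cancel₀ ha, map_one, one_mul] at h1
  exact x_notMem_placeInfinity h1

/-- An element of `Y₂` is integral over `K[x]` if and only if it has no pole outside `P_∞`. -/
theorem isIntegral_iff_forall_place (z : Y₂ K n) :
    IsIntegral K[X] z ↔ ∀ P : Place K (Y₂ K n), P ≠ placeInfinity K n → z ∈ P.valuationRing := by
  let s : Set (Y₂ K n) := Set.range (algebraMap K[X] (Y₂ K n))
  have hs : Subring.closure s = (algebraMap K[X] (Y₂ K n)).range :=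
    Subring.closure_eq (algebraMap K[X] (Y₂ K n)).range
  have hint : IsIntegral K[X] z ↔ IsIntegral (Subring.closure s) z := by
    have hsur : Function.Surjective
        (algebraMap K[X] (Y₂ K n)).rangeRestrict := RingHom.rangeRestrict_surjective _
    rw [hs]
    constructor
    · rintro ⟨p, hp, h0⟩
      refine ⟨p.map (algebraMap K[X] (Y₂ K n)).rangeRestrict, hp.map _, ?_⟩
      rw [eval₂_map]
      exact h0
    · rintro ⟨p, hp, h0⟩
      obtain ⟨g, rfl, -, hg⟩ := lifts_and_natDegree_eq_and_monic
        (map_surjective _ hsur p) hp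
      refine ⟨g, hg, ?_⟩
      rw [eval₂_map] at h0
      exact h0
  have key : IsIntegral (Subring.closure s) z ↔
      ∀ V : ValuationSubring (Y₂ K n), s ⊆ V → z ∈ V := by
    change z ∈ (integralClosure (Subring.closure s) (Y₂ K n)).toSubring ↔ _
    rw [← iInf_valuationSubring_superset, Subring.mem_iInf]
    exact ⟨fun hall V hV => hall ⟨V, hV⟩, fun hall V => hall V.1 V.2⟩
  have hxs : x K n ∈ s := ⟨X, by
    rw [IsScalarTower.algebraMap_apply K[X] (RatFunc K), RatFunc.algebraMap_X]; rfl⟩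
  have hKs : ∀ c, algebraMap K (Y₂ K n) c ∈ s := fun c => ⟨C c, by
    rw [← Polynomial.algebraMap_eq, ← IsScalarTower.algebraMap_apply]⟩
  rw [hint, key]
  constructor
  · intro hall P hP
    have hxP : x K n ∈ P.valuationRing := by
      by_contra hx
      exact hP (P.eq_placeInfinity_iff.2 hx)
    refine hall _ ?_
    rintro _ ⟨p, rfl⟩
    induction p using Polynomial.induction_on' with
    | add p q hp hq => rw [map_add]; exact P.valuationRing.add_mem _ _ hp hq
    | monomial k c =>
      rw [← C_mul_X_pow_eq_monomial, map_mul, map_pow]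
      refine P.valuationRing.mul_mem _ _ ?_ (pow_mem ?_ k)
      · rw [← Polynomial.algebraMap_eq, ← IsScalarTower.algebraMap_apply]
        exact P.algebraMap_mem c
      · rw [IsScalarTower.algebraMap_apply K[X] (RatFunc K), RatFunc.algebraMap_X]
        exact hxP
  · intro hall V hV
    by_cases htop : V = ⊤
    · exact htop ▸ ValuationSubring.mem_top z
    · refine hall ⟨V, fun c => hV (hKs c), htop⟩ fun e => ?_
      exact (Place.eq_placeInfinity_iff _).1 e (hV hxs)

theorem isIntegral_map_of_mem_stabilizer {σ : Y₂ K n ≃ₐ[K] Y₂ K n}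
    (hσ : σ ∈ (placeInfinity K n).stabilizer) {z : Y₂ K n} (hz : IsIntegral K[X] z) :
    IsIntegral K[X] (σ z) := by
  rw [isIntegral_iff_forall_place] at hz ⊢
  intro P hP
  refine (P.mem_comap_valuationRing σ z).1 (hz _ fun e => hP ?_)
  rw [Place.mem_stabilizer_iff_comap_eq] at hσ
  refine Place.ext_valuationRing (SetLike.ext fun w => ?_)
  have h1 := P.mem_comap_valuationRing σ (σ.symm w)
  have h2 := (placeInfinity K n).mem_comap_valuationRing σ (σ.symm w)
  rw [e, AlgEquiv.apply_symm_apply] at h1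
  rw [hσ, AlgEquiv.apply_symm_apply] at h2
  exact h1.symm.trans h2

end poles

/-! ### The ring of functions regular outside the place at infinity -/

section integralClosure

variable (K : Type*) [Field K] (m : ℕ)

theorem defPoly_monic_natDegree :
    (defPoly K (m + 1)).Monic ∧ (defPoly K (m + 1)).natDegree = 2 ^ m := by
  obtain ⟨hmon, hdeg⟩ := h_succ_monic_natDegree K m
  constructor
  · refine (hmon.map _).sub_of_left (degree_C_le.trans_lt ?_)
    rw [hmon.degree_map, degree_eq_natDegree hmon.ne_zero, hdeg]
    exact_mod_cast Nat.pow_pos (by norm_num)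
  · rw [defPoly, natDegree_sub_C, natDegree_map, hdeg]

theorem derivative_h [CharP K 2] (n : ℕ) [NeZero n] : derivative (h K n) = 1 := by
  obtain ⟨m, rfl⟩ := Nat.exists_eq_succ_of_ne_zero (NeZero.ne n)
  rw [h, Finset.sum_range_succ', derivative_add, derivative_sum, Finset.sum_eq_zero]
  · simp
  · intro i _
    rw [derivative_X_pow, pow_succ, Nat.cast_mul, CharP.cast_eq_zero K 2, mul_zero, map_zero,
      zero_mul]

theorem derivative_defPoly [CharP K 2] (n : ℕ) [NeZero n] : derivative (defPoly K n) = 1 := by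
  rw [defPoly, derivative_sub, derivative_map, derivative_h, derivative_C, sub_zero,
    Polynomial.map_one]

theorem minpoly_y : minpoly (RatFunc K) (y K (m + 1)) = defPoly K (m + 1) := by
  have hmon := (defPoly_monic_natDegree K m).1
  rw [y, AdjoinRoot.minpoly_root hmon.ne_zero, hmon.leadingCoeff, inv_one, C_1, mul_one]

theorem isSeparable_Y₂ [CharP K 2] (n : ℕ) [NeZero n] :
    Algebra.IsSeparable (RatFunc K) (Y₂ K n) := by
  obtain ⟨m, rfl⟩ := Nat.exists_eq_succ_of_ne_zero (NeZero.ne n)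
  rw [← separableClosure.eq_top_iff, eq_top_iff]
  have hy : y K (m + 1) ∈ separableClosure (RatFunc K) (Y₂ K (m + 1)) := by
    rw [mem_separableClosure_iff, IsSeparable, minpoly_y, separable_def, derivative_defPoly]
    exact isCoprime_one_right
  intro z _
  have hz : z ∈ Algebra.adjoin (RatFunc K) {AdjoinRoot.root (defPoly K (m + 1))} := by
    rw [AdjoinRoot.adjoinRoot_eq_top]; trivial
  refine Algebra.adjoin_le (S := (separableClosure (RatFunc K) (Y₂ K (m + 1))).toSubalgebra) ?_ hz
  rw [Set.singleton_subset_iff]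
  exact hy

/-- The defining polynomial of `Y₂` over `K[x]`. -/
def integralDefPoly (n : ℕ) : K[X][X] := (h K n).map C - C (X ^ (2 ^ n + 1))

theorem map_integralDefPoly (n : ℕ) :
    (integralDefPoly K n).map (algebraMap K[X] (RatFunc K)) = defPoly K n := by
  rw [integralDefPoly, defPoly, Polynomial.map_sub, Polynomial.map_map, Polynomial.map_C,
    map_pow (algebraMap K[X] (RatFunc K)), RatFunc.algebraMap_X]
  congr 2

theorem integralDefPoly_monic_natDegree :
    (integralDefPoly K (m + 1)).Monic ∧ (integralDefPoly K (m + 1)).natDegree = 2 ^ m := by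
  have hinj := IsFractionRing.injective K[X] (RatFunc K)
  obtain ⟨h1, h2⟩ := defPoly_monic_natDegree K m
  rw [← map_integralDefPoly] at h1 h2
  exact ⟨monic_of_injective hinj h1, by rwa [natDegree_map_eq_of_injective hinj] at h2⟩

theorem aeval_y_integralDefPoly (n : ℕ) : aeval (y K n) (integralDefPoly K n) = 0 := by
  rw [← aeval_map_algebraMap (RatFunc K), map_integralDefPoly, y, AdjoinRoot.aeval_eq,
    AdjoinRoot.mk_self]

/-- The integral closure of `K[x]` in `Y₂` is `K[x, y]`: the discriminant of the powers of `y`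
is, up to sign, the norm of the derivative of the defining polynomial at `y`, and this derivative is
`1` in characteristic two. -/
theorem exists_eq_aeval_of_isIntegral [CharP K 2] {z : Y₂ K (m + 1)} (hz : IsIntegral K[X] z) :
    ∃ f : K[X][X], f.natDegree < 2 ^ m ∧ z = aeval (y K (m + 1)) f := by
  have hsep := isSeparable_Y₂ K (m + 1)
  obtain ⟨hmon, hdeg⟩ := integralDefPoly_monic_natDegree K m
  have hmon' := (defPoly_monic_natDegree K m).1
  let B := AdjoinRoot.powerBasis hmon'.ne_zero
  have hgen : B.gen = y K (m + 1) := AdjoinRoot.powerBasis_gen _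
  have hint : IsIntegral K[X] B.gen := ⟨_, hmon, by
    rw [hgen]; exact aeval_y_integralDefPoly K (m + 1)⟩
  have : Module.Finite (RatFunc K) (Y₂ K (m + 1)) := B.finite
  have hdisc : Algebra.discr (RatFunc K) B.basis = 1 := by
    have : CharP (RatFunc K) 2 := charP_of_injective_algebraMap
      (algebraMap K (RatFunc K)).injective 2
    rw [Algebra.discr_powerBasis_eq_norm, hgen, minpoly_y, derivative_defPoly, map_one, map_one,
      mul_one, CharTwo.neg_eq, one_pow]
  have hmem := Algebra.discr_mul_isIntegral_mem_adjoin (RatFunc K) hint hz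
  rw [hdisc, one_smul, hgen, Algebra.adjoin_singleton_eq_range_aeval] at hmem
  obtain ⟨g, hg⟩ := hmem
  refine ⟨g %ₘ integralDefPoly K (m + 1), ?_, ?_⟩
  · rw [← hdeg]
    refine natDegree_modByMonic_lt _ hmon fun h1 => ?_
    rw [h1, natDegree_one] at hdeg
    exact absurd hdeg (by positivity)
  · rw [← hg]
    conv_lhs => rw [← modByMonic_add_div g (integralDefPoly K (m + 1))]
    simp [aeval_y_integralDefPoly]

theorem eq_zero_of_aeval_y_eq_zero {f : (RatFunc K)[X]} (hf : f.natDegree < 2 ^ m)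
    (h0 : aeval (y K (m + 1)) f = 0) : f = 0 := by
  by_contra hne
  have hle := natDegree_le_of_dvd (minpoly.dvd _ _ h0) hne
  rw [minpoly_y, (defPoly_monic_natDegree K m).2] at hle
  omega

theorem algebraMap_polynomial (n : ℕ) (p : K[X]) :
    algebraMap K[X] (Y₂ K n) p = aeval (x K n) p := by
  induction p using Polynomial.induction_on' with
  | add p q hp hq => rw [map_add, map_add, hp, hq]
  | monomial k c =>
    rw [← C_mul_X_pow_eq_monomial, map_mul, map_pow, map_mul, map_pow, aeval_C, aeval_X,
      ← Polynomial.algebraMap_eq, ← IsScalarTower.algebraMap_apply,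
      IsScalarTower.algebraMap_apply K[X] (RatFunc K) _ X, RatFunc.algebraMap_X]
    rfl

theorem aeval_x_injective (n : ℕ) [NeZero n] : Function.Injective (aeval (R := K) (x K n)) := by
  intro p r hpr
  rw [← algebraMap_polynomial, ← algebraMap_polynomial,
    IsScalarTower.algebraMap_apply K[X] (RatFunc K),
    IsScalarTower.algebraMap_apply K[X] (RatFunc K) _ r] at hpr
  exact IsFractionRing.injective K[X] (RatFunc K)
    ((algebraMap (RatFunc K) (Y₂ K n)).injective hpr)

end integralClosure

/-! ### Functions with small pole order at infinity -/

section poleOrder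

variable {K : Type*} [Field K] {m : ℕ}

variable (K m) in
/-- The valuation of `Y₂` at the place at infinity. -/
abbrev vInf : Valuation (Y₂ K (m + 1)) (placeInfinity K (m + 1)).valuationRing.ValueGroup :=
  (placeInfinity K (m + 1)).valuationRing.valuation

theorem one_lt_valuation_x : 1 < vInf K m (x K (m + 1)) :=
  (placeInfinity_liesOverInfinity K (m + 1)).one_lt_valuation_x

theorem valuation_y_pow :
    vInf K m (y K (m + 1)) ^ 2 ^ m = vInf K m (x K (m + 1)) ^ (2 * 2 ^ m + 1) := by
  rw [← pow_succ' 2 m]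
  exact (placeInfinity_liesOverInfinity K (m + 1)).valuation_y_pow

theorem valuation_aeval_x {p : K[X]} (hp : p ≠ 0) :
    vInf K m (aeval (x K (m + 1)) p) = vInf K m (x K (m + 1)) ^ p.natDegree :=
  have := (placeInfinity K (m + 1)).isTrivialOn
  valuation_aeval_eq_valuation_X_pow_natDegree_of_one_lt_valuation_X _ one_lt_valuation_x hp

/-- Pole orders, with those of `x` and `y` equal to `q/2` and `q + 1`: if `∑ fⱼ(x) yʲ` with
`j < q/2` has pole order at most that of `x ^ s`, then so has every single term. -/
theorem pole_order_coeff_le {f : K[X][X]} (hf : f.natDegree < 2 ^ m) {s : ℕ}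
    (hv : vInf K m (aeval (y K (m + 1)) f) ≤ vInf K m (x K (m + 1)) ^ s) {j : ℕ}
    (hj : f.coeff j ≠ 0) :
    (f.coeff j).natDegree * 2 ^ m + j * (2 * 2 ^ m + 1) ≤ s * 2 ^ m := by
  have hP := placeInfinity_liesOverInfinity K (m + 1)
  have hx0 : x K (m + 1) ≠ 0 :=
    (Valuation.ne_zero_iff (vInf K m)).1 (zero_lt_one.trans one_lt_valuation_x).ne'
  have hXs : (RatFunc.X ^ s : RatFunc K) = algebraMap K[X] (RatFunc K) (X ^ s) := by
    rw [map_pow, RatFunc.algebraMap_X]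
  have hXs0 : (RatFunc.X ^ s : RatFunc K) ≠ 0 := pow_ne_zero _ RatFunc.X_ne_zero
  set g : (RatFunc K)[X] := C (RatFunc.X ^ s)⁻¹ * f.map (algebraMap K[X] (RatFunc K)) with hg
  have hinj := IsFractionRing.injective K[X] (RatFunc K)
  have hgdeg : g.natDegree < 2 ^ m := by
    rw [hg, natDegree_C_mul (inv_ne_zero hXs0), natDegree_map_eq_of_injective hinj]
    exact hf
  have hgy : aeval (y K (m + 1)) g = (x K (m + 1) ^ s)⁻¹ * aeval (y K (m + 1)) f := by
    rw [hg, map_mul, aeval_C, aeval_map_algebraMap, map_inv₀, map_pow]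
    rfl
  have hmem : aeval (y K (m + 1)) g ∈ (placeInfinity K (m + 1)).valuationRing := by
    rw [← ValuationSubring.valuation_le_one_iff, hgy, map_mul, map_inv₀, map_pow]
    exact inv_mul_le_one_of_le₀ hv zero_le
  have hjN : j < 2 ^ m := (le_natDegree_of_ne_zero hj).trans_lt hf
  have hfj : algebraMap K[X] (RatFunc K) (f.coeff j) ≠ 0 := by
    rwa [ne_eq, map_eq_zero_iff _ hinj]
  have hcoeff : g.coeff j = (RatFunc.X ^ s)⁻¹ * algebraMap K[X] (RatFunc K) (f.coeff j) := by
    rw [hg, coeff_C_mul, coeff_map]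
  have h1 := ((hP.aeval_mem_iff hgdeg).1 hmem j hjN).resolve_left (by
    rw [hcoeff]; exact mul_ne_zero (inv_ne_zero hXs0) hfj)
  rw [hcoeff, RatFunc.intDegree_mul (inv_ne_zero hXs0) hfj, RatFunc.intDegree_inv, hXs,
    RatFunc.intDegree_polynomial, RatFunc.intDegree_polynomial, natDegree_X_pow] at h1
  have h2 : (((f.coeff j).natDegree * 2 ^ m + j * (2 * 2 ^ m + 1) : ℕ) : ℤ) ≤
      ((s * 2 ^ m : ℕ) : ℤ) := by
    push_cast at h1 ⊢
    rw [pow_succ'] at h1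
    linarith
  exact_mod_cast h2

/-- The Riemann–Roch space of the pole divisor of `x`. -/
theorem exists_eq_of_valuation_le_x [CharP K 2] {z : Y₂ K (m + 1)} (hz : IsIntegral K[X] z)
    (hv : vInf K m z ≤ vInf K m (x K (m + 1))) :
    ∃ a b : K, z = algebraMap K _ a * x K (m + 1) + algebraMap K _ b := by
  obtain ⟨f, hf, rfl⟩ := exists_eq_aeval_of_isIntegral K m hz
  rw [← pow_one (vInf K m (x K (m + 1)))] at hv
  have hN : 0 < 2 ^ m := by positivity
  have hfC : f = C (f.coeff 0) := by
    refine eq_C_of_natDegree_le_zero (natDegree_le_iff_coeff_eq_zero.2 fun j hj => ?_)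
    by_contra hne
    have := pole_order_coeff_le hf hv hne
    nlinarith
  have hdeg : (f.coeff 0).natDegree ≤ 1 := by
    by_cases h0 : f.coeff 0 = 0
    · simp [h0]
    · have := pole_order_coeff_le hf hv h0
      nlinarith
  obtain ⟨a, b, hab⟩ := exists_eq_X_add_C_of_natDegree_le_one hdeg
  refine ⟨a, b, ?_⟩
  rw [hfC, aeval_C, algebraMap_polynomial, hab]
  simp

theorem valuation_y_le : vInf K m (y K (m + 1)) ≤ vInf K m (x K (m + 1)) ^ 3 := by
  have hN : 2 ^ m ≠ 0 := by positivity
  rw [← pow_le_pow_iff_left₀ zero_le zero_le hN, valuation_y_pow, ← pow_mul]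
  exact pow_le_pow_right₀ one_lt_valuation_x.le (by have := Nat.pos_of_ne_zero hN; omega)

/-- The Riemann–Roch space of the pole divisor of `y`. -/
theorem exists_eq_of_valuation_le_y [CharP K 2] (hm : m ≠ 0) {z : Y₂ K (m + 1)}
    (hz : IsIntegral K[X] z) (hv : vInf K m z ≤ vInf K m (y K (m + 1))) :
    ∃ (d : K) (p : K[X]), p.natDegree ≤ 2 ∧
      z = algebraMap K _ d * y K (m + 1) + aeval (x K (m + 1)) p := by
  obtain ⟨f, hf, rfl⟩ := exists_eq_aeval_of_isIntegral K m hz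
  have hv3 := hv.trans valuation_y_le
  have hN : 2 ≤ 2 ^ m := Nat.le_self_pow hm 2
  have hfX : f.natDegree ≤ 1 := by
    refine natDegree_le_iff_coeff_eq_zero.2 fun j hj => ?_
    by_contra hne
    have := pole_order_coeff_le hf hv3 hne
    nlinarith
  have hdeg : (f.coeff 1).natDegree ≤ 0 := by
    by_cases h0 : f.coeff 1 = 0
    · simp [h0]
    · have := pole_order_coeff_le hf hv3 h0
      nlinarith
  obtain ⟨d, hd⟩ : ∃ d, f.coeff 1 = C d := ⟨_, eq_C_of_natDegree_le_zero hdeg⟩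
  have heq : aeval (y K (m + 1)) f = algebraMap K _ d * y K (m + 1) +
      aeval (x K (m + 1)) (f.coeff 0) := by
    conv_lhs => rw [eq_X_add_C_of_natDegree_le_one hfX]
    rw [hd]
    simp [algebraMap_polynomial]
  refine ⟨d, f.coeff 0, ?_, heq⟩
  by_cases h0 : f.coeff 0 = 0
  · simp [h0]
  have hle : vInf K m (aeval (x K (m + 1)) (f.coeff 0)) ≤ vInf K m (y K (m + 1)) := by
    rw [← sub_eq_iff_eq_add'] at heq
    rw [← heq]
    refine (vInf K m).map_sub_le hv ?_
    rw [map_mul]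
    exact mul_le_of_le_one_left' ((ValuationSubring.valuation_le_one_iff _ _).2
      ((placeInfinity K (m + 1)).algebraMap_mem d))
  rw [valuation_aeval_x h0, ← pow_le_pow_iff_left₀ zero_le zero_le (by omega : 2 ^ m ≠ 0),
    valuation_y_pow, ← pow_mul, pow_le_pow_iff_right₀ one_lt_valuation_x] at hle
  by_contra hlt
  nlinarith

theorem y_ne_aeval_x (hm : m ≠ 0) (p : K[X]) : y K (m + 1) ≠ aeval (x K (m + 1)) p := by
  intro heq
  have hpow := valuation_y_pow (K := K) (m := m)
  have hN : 2 ≤ 2 ^ m := Nat.le_self_pow hm 2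
  have hx := one_lt_valuation_x (K := K) (m := m)
  by_cases h0 : p = 0
  · rw [heq, h0, map_zero, map_zero, zero_pow (by omega)] at hpow
    exact (pow_pos (zero_lt_one.trans hx) _).ne hpow
  · rw [heq, valuation_aeval_x h0, ← pow_mul] at hpow
    have h1 := pow_right_injective₀ (zero_lt_one.trans hx) hx.ne' hpow
    have h2 : 2 ^ m ∣ 1 :=
      (Nat.dvd_add_right (dvd_mul_left (2 ^ m) 2)).1 (h1 ▸ dvd_mul_left (2 ^ m) _)
    exact absurd (Nat.le_of_dvd one_pos h2) (by omega)

end poleOrder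

/-! ### The additive polynomial `h` -/

section additive

variable {K : Type*} [Field K] {A : Type*} [CommRing A] [Algebra K A]

theorem aeval_h (n : ℕ) (u : A) : aeval u (h K n) = ∑ i ∈ Finset.range n, u ^ 2 ^ i := by
  simp [h]

theorem aeval_h_add [CharP A 2] (n : ℕ) (u w : A) :
    aeval (u + w) (h K n) = aeval u (h K n) + aeval w (h K n) := by
  simp only [aeval_h, ← Finset.sum_add_distrib]
  exact Finset.sum_congr rfl fun i _ => add_pow_char_pow u w 2 i

/-- The sum telescopes since `h(u²) = h(u)² = u² + u⁴ + ⋯ + u ^ q`. -/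
theorem aeval_h_sq_add [CharP A 2] (n : ℕ) (u : A) :
    aeval (u ^ 2) (h K n) + aeval u (h K n) = u ^ 2 ^ n + u := by
  simp only [aeval_h]
  induction n with
  | zero => simp [CharTwo.add_self_eq_zero]
  | succ k ih =>
    rw [Finset.sum_range_succ, Finset.sum_range_succ, ← pow_mul, ← pow_succ']
    linear_combination ih + CharTwo.add_self_eq_zero (u ^ 2 ^ k)

/-- The substitution `(x, y) ↦ (a x + b, y + f² x² + f x + c)` preserves the equation
`h(y) = x ^ (q + 1)`. -/
theorem aeval_h_transform [CharP A 2] {n : ℕ} {x y a b c f : A}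
    (hxy : aeval y (h K n) = x ^ (2 ^ n + 1)) (ha : a ^ (2 ^ n + 1) = 1)
    (hf : f = a * b ^ 2 ^ n) (hfq : f ^ 2 ^ n = a ^ 2 ^ n * b)
    (hbc : aeval c (h K n) = b ^ (2 ^ n + 1)) :
    aeval (y + f ^ 2 * x ^ 2 + f * x + c) (h K n) = (a * x + b) ^ (2 ^ n + 1) := by
  have htel := aeval_h_sq_add (K := K) n (f * x)
  rw [mul_pow, mul_pow, hfq] at htel
  rw [aeval_h_add, aeval_h_add, aeval_h_add, hxy, hbc, pow_succ (a * x + b), add_pow_char_pow,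
    mul_pow]
  rw [pow_succ] at ha
  linear_combination htel + x * hf - x ^ 2 ^ n * x * ha

end additive

theorem charP_Y₂ (K : Type*) [Field K] [CharP K 2] (n : ℕ) [NeZero n] : CharP (Y₂ K n) 2 :=
  charP_of_injective_algebraMap (algebraMap K (Y₂ K n)).injective 2

/-! ### Automorphisms given by the images of `x` and `y` -/

section automorphisms

variable {K : Type*} [Field K] {n : ℕ} [NeZero n]

theorem algHom_ext {F : Type*} [Field F] [Algebra K F] {σ τ : Y₂ K n →ₐ[K] F}
    (hx : σ (x K n) = τ (x K n)) (hy : σ (y K n) = τ (y K n)) : σ = τ := by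
  have hrat : ∀ r : RatFunc K,
      σ (algebraMap (RatFunc K) _ r) = τ (algebraMap (RatFunc K) _ r) := by
    intro r
    have hpoly : ∀ p : K[X], σ (algebraMap (RatFunc K) _ (algebraMap K[X] (RatFunc K) p)) =
        τ (algebraMap (RatFunc K) _ (algebraMap K[X] (RatFunc K) p)) := by
      intro p
      rw [← IsScalarTower.algebraMap_apply, algebraMap_polynomial, ← aeval_algHom_apply,
        ← aeval_algHom_apply, hx]
    induction r using RatFunc.induction_on with
    | f p s hs => simp only [map_div₀, hpoly]
  refine AlgHom.ext fun z => ?_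
  induction z using AdjoinRoot.induction_on with
  | ih f =>
    induction f using Polynomial.induction_on' with
    | add f g hf hg => simp only [map_add, hf, hg]
    | monomial k c =>
      rw [← C_mul_X_pow_eq_monomial, map_mul, map_pow, AdjoinRoot.mk_C, AdjoinRoot.mk_X]
      change σ (algebraMap (RatFunc K) _ c * y K n ^ k) = τ (algebraMap (RatFunc K) _ c * y K n ^ k)
      rw [map_mul, map_mul, map_pow, map_pow, hrat, hy]

/-- A pair `(u, w)` with `h(w) = u ^ (q + 1)` and `u` transcendental gives an embedding of
`K(x, y)`. -/
theorem exists_algHom {F : Type*} [Field F] [Algebra K F] {u w : F} (hu : Transcendental K u)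
    (huw : aeval w (h K n) = u ^ (2 ^ n + 1)) :
    ∃ σ : Y₂ K n →ₐ[K] F, σ (x K n) = u ∧ σ (y K n) = w := by
  have hinj : Function.Injective (aeval (R := K) u) := transcendental_iff_injective.1 hu
  have hle : nonZeroDivisors K[X] ≤ (nonZeroDivisors F).comap (aeval (R := K) u) :=
    nonZeroDivisors_le_comap_nonZeroDivisors_of_injective _ hinj
  let φ : RatFunc K →ₐ[K] F := RatFunc.liftAlgHom (aeval u) hle
  have hφX : φ RatFunc.X = u := by
    rw [← RatFunc.algebraMap_X]
    have := RatFunc.liftAlgHom_apply_div (aeval u) hle (X : K[X]) 1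
    rwa [map_one, map_one, div_one, div_one, aeval_X] at this
  have h0 : (defPoly K n).eval₂ (φ : RatFunc K →+* F) w = 0 := by
    rw [defPoly, eval₂_sub, eval₂_map, eval₂_C, map_pow, sub_eq_zero]
    change _ = φ RatFunc.X ^ _
    rw [hφX, ← huw, aeval_def]
    congr 1
    ext c
    exact φ.commutes c
  refine ⟨AdjoinRoot.liftAlgHom (defPoly K n) φ w h0, ?_, AdjoinRoot.liftAlgHom_root ..⟩
  exact (AdjoinRoot.liftAlgHom_of ..).trans hφX

theorem transcendental_x : Transcendental K (x K n) :=
  transcendental_iff_injective.2 (aeval_x_injective K n)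

theorem transcendental_affine {a b : K} (ha : a ≠ 0) :
    Transcendental K (algebraMap K _ a * x K n + algebraMap K _ b) := by
  intro halg
  refine transcendental_x (K := K) (n := n) ?_
  have h1 := (isAlgebraic_algebraMap (A := Y₂ K n) a⁻¹).mul
    (halg.sub (isAlgebraic_algebraMap (A := Y₂ K n) b))
  rwa [add_sub_cancel_right, ← mul_assoc, ← map_mul, inv_mul_cancel₀ ha, map_one, one_mul] at h1

theorem surjective_of_mem_fieldRange {σ : Y₂ K n →ₐ[K] Y₂ K n} (hx : x K n ∈ σ.fieldRange)
    (hy : y K n ∈ σ.fieldRange) : Function.Surjective σ := by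
  -- `K(x, y)` maps to the range of `σ` by a section of the inclusion of that range.
  obtain ⟨τ, hτx, hτy⟩ := exists_algHom (K := K) (n := n) (F := σ.fieldRange)
    (u := ⟨x K n, hx⟩) (w := ⟨y K n, hy⟩)
    (fun halg => transcendental_x (K := K) (n := n) (halg.algHom σ.fieldRange.val))
    (Subtype.ext (by
      have := aeval_algHom_apply σ.fieldRange.val (⟨y K n, hy⟩ : σ.fieldRange) (h K n)
      exact this.symm.trans (aeval_y K n)))
  have hid : σ.fieldRange.val.comp τ = AlgHom.id K (Y₂ K n) :=
    algHom_ext (by simp [hτx]) (by simp [hτy])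
  intro z
  obtain ⟨w, hw⟩ := (τ z).2
  exact ⟨w, hw.trans (DFunLike.congr_fun hid z)⟩

theorem exists_algEquiv [CharP K 2] {a b c f : K} (ha : a ^ (2 ^ n + 1) = 1)
    (hf : f = a * b ^ 2 ^ n) (hfq : f ^ 2 ^ n = a ^ 2 ^ n * b)
    (hbc : b ^ (2 ^ n + 1) = (h K n).eval c) :
    ∃ σ : Y₂ K n ≃ₐ[K] Y₂ K n,
      σ (x K n) = algebraMap K _ a * x K n + algebraMap K _ b ∧
      σ (y K n) = y K n + algebraMap K _ (f ^ 2) * x K n ^ 2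
        + algebraMap K _ f * x K n + algebraMap K _ c := by
  have := charP_Y₂ K n
  have ha0 : a ≠ 0 := by
    rintro rfl
    rw [zero_pow (Nat.succ_ne_zero _)] at ha
    exact zero_ne_one ha
  have hrel := aeval_h_transform (K := K) (A := Y₂ K n) (n := n)
    (a := algebraMap K _ a) (b := algebraMap K _ b) (c := algebraMap K _ c)
    (f := algebraMap K _ f) (aeval_y K n) (by rw [← map_pow, ha, map_one])
    (by rw [hf, map_mul, map_pow]) (by rw [← map_pow, hfq, map_mul, map_pow])
    (by rw [aeval_algebraMap_apply_eq_algebraMap_eval, ← hbc, map_pow])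
  rw [← map_pow (algebraMap K (Y₂ K n)) f 2] at hrel
  obtain ⟨σ, hσx, hσy⟩ := exists_algHom (transcendental_affine (n := n) (b := b) ha0) hrel
  obtain ⟨u, hu⟩ : ∃ u, σ u = x K n := by
    refine ⟨algebraMap K _ a⁻¹ * (x K n - algebraMap K _ b), ?_⟩
    rw [map_mul, map_sub, AlgHom.commutes, AlgHom.commutes, hσx, add_sub_cancel_right, ← mul_assoc,
      ← map_mul, inv_mul_cancel₀ ha0, map_one, one_mul]
  have hw : σ (y K n - (algebraMap K _ (f ^ 2) * u ^ 2 + algebraMap K _ f * u +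
      algebraMap K _ c)) = y K n := by
    rw [map_sub, map_add, map_add, map_mul, map_mul, map_pow σ u, AlgHom.commutes, AlgHom.commutes,
      AlgHom.commutes, hu, hσy]
    ring
  exact ⟨AlgEquiv.ofBijective σ ⟨σ.injective, surjective_of_mem_fieldRange ⟨u, hu⟩ ⟨_, hw⟩⟩,
    hσx, hσy⟩

end automorphisms

/-! ### The images of `x` and `y` under an automorphism fixing the place at infinity -/

section images

variable {K : Type*} [Field K] {m : ℕ}

theorem isIntegral_x (n : ℕ) [NeZero n] : IsIntegral K[X] (x K n) := by
  have h1 := algebraMap_polynomial K n X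
  rw [aeval_X] at h1
  rw [← h1]
  exact isIntegral_algebraMap

theorem isIntegral_y : IsIntegral K[X] (y K (m + 1)) :=
  ⟨_, (integralDefPoly_monic_natDegree K m).1, aeval_y_integralDefPoly K (m + 1)⟩

/-- Among the nonconstant functions regular outside the place at infinity, the pole order of `x` is
minimal, and it is attained only by `a x + b` with `a ≠ 0`. -/
theorem map_x_of_mem_stabilizer [CharP K 2] {σ : Y₂ K (m + 1) ≃ₐ[K] Y₂ K (m + 1)}
    (hσ : σ ∈ (placeInfinity K (m + 1)).stabilizer) :
    ∃ a b : K, a ≠ 0 ∧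
      σ (x K (m + 1)) = algebraMap K _ a * x K (m + 1) + algebraMap K _ b := by
  have hnc : ∀ c : K, x K (m + 1) ≠ algebraMap K _ c := fun c hc =>
    x_notMem_placeInfinity (hc ▸ (placeInfinity K (m + 1)).algebraMap_mem c)
  have hint : IsIntegral K[X] (σ.symm (x K (m + 1))) :=
    isIntegral_map_of_mem_stabilizer (inv_mem hσ) (isIntegral_x _)
  -- In the first case `σ⁻¹(x) = a x + b` is solved for `σ(x)`; in the second, applying `σ` bounds
  -- the pole order of `σ(x)`.
  rcases le_total (vInf K m (σ.symm (x K (m + 1)))) (vInf K m (x K (m + 1))) with hle | hle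
  · obtain ⟨a, b, hab⟩ := exists_eq_of_valuation_le_x hint hle
    have hx := congrArg σ hab
    rw [AlgEquiv.apply_symm_apply, map_add, map_mul, AlgEquiv.commutes, AlgEquiv.commutes] at hx
    have ha : a ≠ 0 := by
      rintro rfl
      exact hnc b (by simpa using hx)
    have ha' : algebraMap K (Y₂ K (m + 1)) a ≠ 0 := (_root_.map_ne_zero _).2 ha
    refine ⟨a⁻¹, -(a⁻¹ * b), inv_ne_zero ha, ?_⟩
    rw [map_neg, map_mul, map_inv₀]
    field_simp
    linear_combination -hx
  · rw [← Place.valuation_map_le_iff hσ, AlgEquiv.apply_symm_apply] at hle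
    obtain ⟨a, b, hab⟩ := exists_eq_of_valuation_le_x
      (isIntegral_map_of_mem_stabilizer hσ (isIntegral_x _)) hle
    refine ⟨a, b, ?_, hab⟩
    rintro rfl
    rw [map_zero, zero_mul, zero_add] at hab
    exact hnc b (σ.injective (by rw [hab, AlgEquiv.commutes]))

theorem natDegree_comp_affine_le (p : K[X]) (a b : K) :
    (p.comp (C a * X + C b)).natDegree ≤ p.natDegree :=
  natDegree_comp_le.trans
    ((Nat.mul_le_mul_left _ natDegree_linear_le).trans (mul_one _).le)

/-- Among the functions regular outside the place at infinity and not in `K[x]`, the pole order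
of `y` is minimal, and it is attained only by `d y + p(x)` with `deg p ≤ 2`. -/
theorem map_y_of_mem_stabilizer [CharP K 2] (hm : m ≠ 0) {σ : Y₂ K (m + 1) ≃ₐ[K] Y₂ K (m + 1)}
    (hσ : σ ∈ (placeInfinity K (m + 1)).stabilizer) :
    ∃ (d : K) (p : K[X]), d ≠ 0 ∧ p.natDegree ≤ 2 ∧
      σ (y K (m + 1)) = algebraMap K _ d * y K (m + 1) + aeval (x K (m + 1)) p := by
  have haff : ∀ {τ : Y₂ K (m + 1) ≃ₐ[K] Y₂ K (m + 1)},
      τ ∈ (placeInfinity K (m + 1)).stabilizer → ∀ p : K[X], ∃ r : K[X],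
        r.natDegree ≤ p.natDegree ∧ τ (aeval (x K (m + 1)) p) = aeval (x K (m + 1)) r := by
    intro τ hτ p
    obtain ⟨a, b, -, hx⟩ := map_x_of_mem_stabilizer hτ
    refine ⟨p.comp (C a * X + C b), natDegree_comp_affine_le p a b, ?_⟩
    rw [aeval_comp, ← aeval_algHom_apply, hx]
    simp
  have hσ' : σ.symm ∈ (placeInfinity K (m + 1)).stabilizer := inv_mem hσ
  rcases le_total (vInf K m (σ.symm (y K (m + 1)))) (vInf K m (y K (m + 1))) with hle | hle
  · obtain ⟨d, p, hp, hdp⟩ :=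
      exists_eq_of_valuation_le_y hm (isIntegral_map_of_mem_stabilizer hσ' isIntegral_y) hle
    obtain ⟨r, hr, hpr⟩ := haff hσ p
    have hy := congrArg σ hdp
    rw [AlgEquiv.apply_symm_apply, map_add, map_mul, AlgEquiv.commutes, hpr] at hy
    have hd : d ≠ 0 := by
      rintro rfl
      exact y_ne_aeval_x hm r (by simpa using hy)
    have hd' : algebraMap K (Y₂ K (m + 1)) d ≠ 0 := (_root_.map_ne_zero _).2 hd
    refine ⟨d⁻¹, C (-d⁻¹) * r, inv_ne_zero hd, (natDegree_C_mul_le _ _).trans (hr.trans hp), ?_⟩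
    rw [map_mul, aeval_C, map_neg, map_inv₀]
    field_simp
    linear_combination -hy
  · rw [← Place.valuation_map_le_iff hσ, AlgEquiv.apply_symm_apply] at hle
    obtain ⟨d, p, hp, hdp⟩ :=
      exists_eq_of_valuation_le_y hm (isIntegral_map_of_mem_stabilizer hσ isIntegral_y) hle
    refine ⟨d, p, ?_, hp, hdp⟩
    rintro rfl
    obtain ⟨r, -, hpr⟩ := haff hσ' p
    rw [map_zero, zero_mul, zero_add] at hdp
    refine y_ne_aeval_x hm r ?_
    rw [← hpr, ← hdp, AlgEquiv.symm_apply_apply]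

/-- Comparing the coefficients of `y ^ (q/4)` and `y ^ (q/2)` in the transformed equation. -/
theorem coeff_y_eq_one [CharP K 2] (hm : m ≠ 0) {a b d : K} {p : K[X]} (hd : d ≠ 0)
    (hrel : aeval (algebraMap K _ d * y K (m + 1) + aeval (x K (m + 1)) p) (h K (m + 1)) =
      (algebraMap K _ a * x K (m + 1) + algebraMap K _ b) ^ (2 ^ (m + 1) + 1)) : d = 1 := by
  have := charP_Y₂ K (m + 1)
  obtain ⟨k, rfl⟩ : ∃ k, m = k + 1 := Nat.exists_eq_succ_of_ne_zero hm
  set ι : K →+* RatFunc K := algebraMap K (RatFunc K)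
  set g : K[X] := X ^ (2 ^ (k + 1 + 1) + 1) * C (d ^ 2 ^ (k + 1)) + aeval p (h K (k + 1 + 1)) -
    (C a * X + C b) ^ (2 ^ (k + 1 + 1) + 1) with hg
  set G : (RatFunc K)[X] := ∑ i ∈ Finset.range (k + 1),
    C (ι (d ^ 2 ^ i - d ^ 2 ^ (k + 1))) * X ^ 2 ^ i + C (algebraMap K[X] (RatFunc K) g) with hG
  have hy := aeval_y K (k + 1 + 1)
  have hGy : aeval (y K (k + 1 + 1)) G = 0 := by
    rw [aeval_h_add, aeval_h, Finset.sum_range_succ] at hrel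
    rw [aeval_h, Finset.sum_range_succ] at hy
    have hι : ∀ c : K, algebraMap (RatFunc K) (Y₂ K (k + 1 + 1)) (ι c) = algebraMap K _ c :=
      fun c => (IsScalarTower.algebraMap_apply K (RatFunc K) (Y₂ K (k + 1 + 1)) c).symm
    have hgx : algebraMap (RatFunc K) (Y₂ K (k + 1 + 1)) (algebraMap K[X] (RatFunc K) g) =
        x K (k + 1 + 1) ^ (2 ^ (k + 1 + 1) + 1) * algebraMap K _ (d ^ 2 ^ (k + 1)) +
        aeval (aeval (x K (k + 1 + 1)) p) (h K (k + 1 + 1)) -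
        (algebraMap K _ a * x K (k + 1 + 1) + algebraMap K _ b) ^ (2 ^ (k + 1 + 1) + 1) := by
      rw [← IsScalarTower.algebraMap_apply, algebraMap_polynomial, hg, map_sub, map_add,
        ← aeval_algHom_apply]
      simp
    rw [hG, map_add, map_sum, aeval_C, hgx]
    simp only [map_mul, aeval_C, hι, map_pow, aeval_X, map_sub, sub_mul, Finset.sum_sub_distrib,
      ← Finset.mul_sum]
    simp only [mul_pow, ← map_pow] at hrel hy ⊢
    linear_combination hrel - algebraMap K (Y₂ K (k + 1 + 1)) (d ^ 2 ^ (k + 1)) * hy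
  have hGdeg : G.natDegree < 2 ^ (k + 1) := by
    refine (natDegree_add_le _ _).trans_lt (max_lt ?_ (by rw [natDegree_C]; positivity))
    refine (natDegree_sum_le_of_forall_le _ _ (n := 2 ^ k) fun i hi => ?_).trans_lt
      (Nat.pow_lt_pow_right (by norm_num) (Nat.lt_succ_self k))
    exact (natDegree_C_mul_X_pow_le _ _).trans
      (Nat.pow_le_pow_right (by norm_num) (Nat.lt_succ_iff.1 (Finset.mem_range.1 hi)))
  have hG0 := eq_zero_of_aeval_y_eq_zero K (k + 1) hGdeg hGy
  have hcoeff := congrArg (fun f => coeff f (2 ^ k)) hG0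
  have hinj : ∀ i, 2 ^ k = 2 ^ i ↔ k = i := fun i => Nat.pow_right_inj (by norm_num)
  simp only [hG, coeff_add, finsetSum_coeff, coeff_C_mul, coeff_X_pow, hinj, mul_ite, mul_one,
    mul_zero, Finset.sum_ite_eq, Finset.self_mem_range_succ, if_true, coeff_C,
    if_neg (pow_ne_zero k (two_ne_zero (α := ℕ))), add_zero, coeff_zero, map_eq_zero] at hcoeff
  have h1 : d ^ 2 ^ k = 1 := by
    have hk : d ^ 2 ^ k ≠ 0 := pow_ne_zero _ hd
    rw [pow_succ, pow_mul, sq, sub_eq_zero] at hcoeff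
    exact mul_left_cancel₀ hk (hcoeff.symm.trans (mul_one _).symm)
  have h2 : (d - 1) ^ 2 ^ k = 0 := by rw [sub_pow_char_pow, h1, one_pow, sub_self]
  exact sub_eq_zero.1 (pow_eq_zero_iff (by positivity) |>.1 h2)

/-- Comparing coefficients of powers of `x` in the transformed equation. -/
theorem coeff_x_relations [CharP K 2] {n : ℕ} (hn : 2 ≤ n) {a b c e f : K}
    (hrel : X ^ (2 ^ n + 1) + aeval (C e * X ^ 2 + C f * X + C c) (h K n) =
      (C a * X + C b) ^ (2 ^ n + 1)) :
    a ^ (2 ^ n + 1) = 1 ∧ b ^ (2 ^ n + 1) = (h K n).eval c ∧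
      f = a * b ^ 2 ^ n ∧ e = (a * b ^ 2 ^ n) ^ 2 := by
  have hq : 4 ≤ 2 ^ n := (Nat.pow_le_pow_right (by norm_num) hn : 2 ^ 2 ≤ 2 ^ n)
  have hC : aeval (C c) (h K n) = C ((h K n).eval c) := by
    rw [← Polynomial.algebraMap_eq, aeval_algebraMap_apply_eq_algebraMap_eval]
  have hrhs : (C a * X + C b) ^ (2 ^ n + 1) = C (a ^ (2 ^ n + 1)) * X ^ (2 ^ n + 1) +
      C (a ^ 2 ^ n * b) * X ^ 2 ^ n + C (a * b ^ 2 ^ n) * X ^ 1 + C (b ^ (2 ^ n + 1)) := by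
    rw [pow_succ, add_pow_char_pow]
    simp only [mul_pow, C_mul, pow_succ _ (2 ^ n), C_pow]
    ring
  have hlhs : aeval (C e * X ^ 2 + C f * X + C c) (h K n) =
      ∑ i ∈ Finset.range n, C (e ^ 2 ^ i) * X ^ 2 ^ (i + 1) +
      ∑ i ∈ Finset.range n, C (f ^ 2 ^ i) * X ^ 2 ^ i + C ((h K n).eval c) := by
    rw [aeval_h_add, aeval_h_add, hC, aeval_h, aeval_h]
    simp only [mul_pow, ← pow_mul, C_pow, ← pow_succ']
  rw [hrhs, hlhs] at hrel
  have e0 : ∀ i, (0 = 2 ^ i) ↔ False := fun i =>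
    ⟨fun h => absurd h.symm (by positivity), False.elim⟩
  have e1 : ∀ i, (1 = 2 ^ i) ↔ 0 = i := fun i => by
    simpa using Nat.pow_right_inj (a := 2) (by norm_num) (m := 0) (n := i)
  have e2 : ∀ i, (2 = 2 ^ i) ↔ 1 = i := fun i => by
    simpa using Nat.pow_right_inj (a := 2) (by norm_num) (m := 1) (n := i)
  have n1 : ∀ i, (1 = 2 ^ (i + 1)) ↔ False := fun i => by rw [e1]; simp
  have n2 : ∀ i, (2 = 2 ^ (i + 1)) ↔ 0 = i := fun i => by rw [e2]; omega
  have hlt : ∀ i ∈ Finset.range n, 2 ^ i < 2 ^ n + 1 ∧ 2 ^ (i + 1) < 2 ^ n + 1 := fun i hi =>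
    ⟨Nat.lt_succ_of_le (Nat.pow_le_pow_right (by norm_num) (Finset.mem_range.1 hi).le),
      Nat.lt_succ_of_le (Nat.pow_le_pow_right (by norm_num) (Finset.mem_range.1 hi))⟩
  have h0 := congrArg (fun r => coeff r 0) hrel
  have h1 := congrArg (fun r => coeff r 1) hrel
  have h2 := congrArg (fun r => coeff r 2) hrel
  have hlead := congrArg (fun r => coeff r (2 ^ n + 1)) hrel
  simp only [coeff_add, finsetSum_coeff, coeff_C_mul, coeff_X_pow, coeff_C] at h0 h1 h2 hlead
  simp only [e0, if_false, mul_zero, Finset.sum_const_zero, if_true, zero_add,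
    (Nat.succ_ne_zero _).symm] at h0
  rw [Finset.sum_eq_zero fun i hi => by rw [if_neg (hlt i hi).2.ne', mul_zero],
    Finset.sum_eq_zero fun i hi => by rw [if_neg (hlt i hi).1.ne', mul_zero]] at hlead
  have hq1 : ¬ 1 = 2 ^ n + 1 := by omega
  have hq2 : ¬ 2 = 2 ^ n + 1 := by omega
  have hq3 : ¬ 2 ^ n + 1 = 1 := by omega
  have hq4 : ¬ 1 = 2 ^ n := by omega
  have hq5 : ¬ 2 = 2 ^ n := by omega
  have r0 : 0 < n := by omega
  have r1 : 1 < n := by omega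
  simp only [n1, hq1, hq4, if_false, mul_zero, Finset.sum_const_zero, zero_add, add_zero, mul_ite,
    mul_one, e1, Finset.sum_ite_eq, Finset.mem_range, r0, if_true, one_ne_zero, pow_zero,
    pow_one] at h1
  simp only [n2, hq2, hq5, if_false, mul_zero, zero_add, add_zero, mul_ite, mul_one, e2,
    Finset.sum_ite_eq, Finset.mem_range, r0, r1, if_true, two_ne_zero, pow_zero, pow_one,
    OfNat.ofNat_ne_one] at h2
  simp only [hq3, Nat.succ_ne_zero, if_true, if_false, mul_zero, mul_one, add_zero,
    Nat.succ_ne_self] at hlead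
  refine ⟨hlead.symm, h0.symm, h1, ?_⟩
  rw [← h1]
  exact CharTwo.add_eq_zero.1 h2

theorem exists_parameters_of_mem_stabilizer [CharP K 2] (hm : m ≠ 0)
    {σ : Y₂ K (m + 1) ≃ₐ[K] Y₂ K (m + 1)}
    (hσ : σ ∈ (placeInfinity K (m + 1)).stabilizer) :
    ∃ a b c : K, a ^ (2 ^ (m + 1) + 1) = 1 ∧
      b ^ (2 ^ (m + 1) + 1) = (h K (m + 1)).eval c ∧
      σ (x K (m + 1)) = algebraMap K _ a * x K (m + 1) + algebraMap K _ b ∧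
      σ (y K (m + 1)) = y K (m + 1)
        + algebraMap K _ ((a * b ^ 2 ^ (m + 1)) ^ 2) * x K (m + 1) ^ 2
        + algebraMap K _ (a * b ^ 2 ^ (m + 1)) * x K (m + 1) + algebraMap K _ c := by
  have := charP_Y₂ K (m + 1)
  obtain ⟨a, b, -, hx⟩ := map_x_of_mem_stabilizer hσ
  obtain ⟨d, p, hd, hp, hy⟩ := map_y_of_mem_stabilizer hm hσ
  have hrel : aeval (σ (y K (m + 1))) (h K (m + 1)) = σ (x K (m + 1)) ^ (2 ^ (m + 1) + 1) := by
    rw [aeval_algHom_apply, aeval_y, map_pow]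
  rw [hx, hy] at hrel
  obtain rfl := coeff_y_eq_one hm hd hrel
  obtain ⟨e, f, c, rfl⟩ : ∃ e f c : K, p = C e * X ^ 2 + C f * X + C c :=
    ⟨_, _, _, eq_quadratic_of_degree_le_two (degree_le_of_natDegree_le hp)⟩
  have hpoly : X ^ (2 ^ (m + 1) + 1) + aeval (C e * X ^ 2 + C f * X + C c) (h K (m + 1)) =
      (C a * X + C b) ^ (2 ^ (m + 1) + 1) := by
    apply aeval_x_injective K (m + 1)
    rw [map_one, one_mul, aeval_h_add, aeval_y] at hrel
    rw [map_add, ← aeval_algHom_apply, map_pow, aeval_X, hrel]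
    simp
  obtain ⟨ha, hbc, rfl, rfl⟩ := coeff_x_relations (by omega) hpoly
  refine ⟨a, b, c, ha, hbc, hx, ?_⟩
  rw [hy]
  simp only [map_add, map_mul, map_pow, aeval_C, aeval_X, map_one]
  ring

end images

end AbdonTorres

end

theorem proposition3p1 (q n : ℕ) [NeZero n] (hq : q = 2 ^ n) (hq4 : 4 ≤ q)
    (K : Type*) [Field K] (hK : Nat.card K = q ^ 2) :
    (∀ σ : AbdonTorres.Y₂ K n ≃ₐ[K] AbdonTorres.Y₂ K n,
      σ ∈ (AbdonTorres.placeInfinity K n).stabilizer ↔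
        ∃ a b c : K, a ^ (q + 1) = 1 ∧ b ^ (q + 1) = (AbdonTorres.h K n).eval c ∧
          σ (AbdonTorres.x K n) = algebraMap K _ a * AbdonTorres.x K n + algebraMap K _ b ∧
          σ (AbdonTorres.y K n) = AbdonTorres.y K n
            + algebraMap K _ ((a * b ^ q) ^ 2) * AbdonTorres.x K n ^ 2
            + algebraMap K _ (a * b ^ q) * AbdonTorres.x K n + algebraMap K _ c) ∧
    (∀ a b c : K, a ^ (q + 1) = 1 → b ^ (q + 1) = (AbdonTorres.h K n).eval c →
      ∃! σ : AbdonTorres.Y₂ K n ≃ₐ[K] AbdonTorres.Y₂ K n,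
        σ (AbdonTorres.x K n) = algebraMap K _ a * AbdonTorres.x K n + algebraMap K _ b ∧
        σ (AbdonTorres.y K n) = AbdonTorres.y K n
          + algebraMap K _ ((a * b ^ q) ^ 2) * AbdonTorres.x K n ^ 2
          + algebraMap K _ (a * b ^ q) * AbdonTorres.x K n + algebraMap K _ c) := by
  subst hq
  have hn : 2 ≤ n := (Nat.pow_le_pow_iff_right (a := 2) (by norm_num)).1 hq4
  have : Finite K := Nat.finite_of_card_ne_zero (by rw [hK]; positivity)
  have := Fintype.ofFinite K
  rw [Nat.card_eq_fintype_card] at hK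
  have hchar : CharP K 2 := by
    obtain ⟨p, hp⟩ := CharP.exists K
    obtain ⟨k, hprime, hcard⟩ := FiniteField.card K p
    have hdvd : p ∣ (2 ^ n) ^ 2 := by
      rw [← hK, hcard]
      exact dvd_pow_self p k.ne_zero
    have hp2 : p = 2 := (Nat.prime_dvd_prime_iff_eq hprime Nat.prime_two).1
      (hprime.dvd_of_dvd_pow (hprime.dvd_of_dvd_pow hdvd))
    exact hp2 ▸ hp
  constructor
  · intro σ
    constructor
    · intro hσ
      obtain ⟨m, rfl⟩ : ∃ m, n = m + 1 := ⟨n - 1, by omega⟩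
      exact AbdonTorres.exists_parameters_of_mem_stabilizer (by omega) hσ
    · rintro ⟨a, b, c, ha, -, hx, -⟩
      refine AbdonTorres.mem_stabilizer_of_map_x (a := a) ?_ hx
      rintro rfl
      rw [zero_pow (Nat.succ_ne_zero _)] at ha
      exact zero_ne_one ha
  · intro a b c ha hbc
    -- `b ^ (q ^ 2) = b` for every `b` in the field with `q ^ 2` elements
    have hfq : (a * b ^ 2 ^ n) ^ 2 ^ n = a ^ 2 ^ n * b := by
      rw [mul_pow, ← pow_mul, ← sq, ← hK, FiniteField.pow_card]
    obtain ⟨σ, hx, hy⟩ := AbdonTorres.exists_algEquiv ha rfl hfq hbc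
    refine ⟨σ, ⟨hx, hy⟩, fun τ hτ => ?_⟩
    have := AbdonTorres.algHom_ext (σ := (τ : AbdonTorres.Y₂ K n →ₐ[K] AbdonTorres.Y₂ K n))
      (τ := σ) (hτ.1.trans hx.symm) (hτ.2.trans hy.symm)
    exact AlgEquiv.coe_toAlgHom_injective this
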